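/- **Conventions.** Let $\mathbb Q^+$ be the set of positive rationals and fix a recursive partition $\mathbb Q^+=\bigcup_{n\in\omega}Q_n$ into pairwise disjoint, topologically dense sets $Q_n$. Trees are sets of transfinite sequences of positive rationals, ordered by extension $\subset$; $|t|$ is the length of a sequence $t$, $T(\alpha)=\{t\in T:|t|=\alpha\}$, $T{\restriction}\alpha=\{t\in T:|t|<\alpha\}$, and $t^\wedge q$ is $t$ extended by the rightmost term $q$. For $|s|=|t|=\alpha$ let $\sum(s,t)=\sum_{\gamma<\alpha}|s_\gamma-t_\gamma|\in[0,\infty]$. For $1\le\mu\le\omega_1$, a *normal $\mu$-tree* is a tree $T$ such that: the empty sequence is not in $T$; if $t\in T$ and $1\le\alpha<|t|$ then $t{\restriction}\alpha\in T$; every non-maximal $t\in T$ has infinitely many immediate successors in $T$, and $T(1)$ is infinite if $\mu>1$ (i.e. the omitted root also has infinitely many immediate successors); all levels are at most countable; $\mu$ is the least ordinal $>0$ greater than all $|t|$, $t\in T$; and if $t\in T$, $|t|<\alpha<\mu$, then $t\subset s$ for some $s\in T(\alpha)$. An *embrion* of height $\mu$ is a system $\mathfrak T=\langle (T_n)_{n\in\omega},\,t\mapsto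 T\langle t\rangle\rangle$ of normal $\mu$-trees $T_n$ and a map assigning to each $t\in T_n$ a set $T\langle t\rangle\subseteq T_{n+1}$, such that for all $n$: 1. $T_n(1)=\{\langle q\rangle:q\in Q_n\}$ if $\mu>1$; and if $t\in T_n$, $|t|+1<\mu$, $q\in\mathbb Q^+$, then $t^\wedge q\in T_n$. 2. For $t\in T_n(\alpha)$, $T\langle t\rangle$ is a normal $\alpha$-tree; and $\bigcup_{t\in T_n}T\langle t\rangle=\{s\in T_{n+1}:|s|+1<\mu\}$. 3. If $t\subset t_1$ (properly) are in $T_n$ then $T\langle t\rangle=T\langle t_1\rangle{\restriction}|t|$. 4. If $t\in T_n$, $|t|+1<\mu$ and $q_1\ne q_2$ then $T\langle t^\wedge q_1\rangle\cap T\langle t^\wedge q_2\rangle=T\langle t\rangle$. 5. For each $s\in T_{n+1}(\alpha)$ with $\alpha+1<\mu$ there is a unique $t\in T_n(\alpha+1)$ with $s\in T\langle t\rangle$; it is denoted $\mathfrak f(s)$. 6. Let $\lambda<\mu$ be a limit ordinal and, for $t\in T_n(\lambda)$, let $L_t=\{s\in T_{n+1}(\lambda): s{\restriction}\gamma\in T\langle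 t\rangle\text{ for all }1\le\gamma<\lambda\}$. Then $T\langle t\rangle\cup L_t$ is a normal $(\lambda+1)$-tree for each $t\in T_n(\lambda)$, and $T_{n+1}(\lambda)=\bigcup_{t\in T_n(\lambda)}L_t$. (For $\lambda+1<\mu$ this follows from the other conditions.) 7. Let $\lambda<\mu$ be a limit ordinal and let $\vartheta<\omega_1$ be the least ordinal such that $L_\vartheta$ (in the constructible hierarchy) models $\mathrm{ZFC}$ without the power set axiom, $\lambda$ is countable in $L_\vartheta$, and both $(T_k{\restriction}\lambda)_{k\in\omega}$ and the map $t\mapsto T\langle t\rangle$ on $\bigcup_kT_k{\restriction}\lambda$ belong to $L_\vartheta$. If such a $\vartheta$ exists (it always does under $V=L$), then for every pre-dense $D\subseteq T_n{\restriction}\lambda$ with $D\in L_\vartheta$, each $t\in T_n(\lambda)$ extends some $s\in D$. 8. If $T$ is $T_0$ or $T\langle u\rangle$ for some $u\in\bigcup_kT_k$, $\lambda$ is a limit ordinal, $\alpha<\lambda$, and $s\ne t$ are in $T(\lambda)$, then $\sum(s{\restriction}\alpha,t{\restriction}\alpha)<\sum(s,t)<+\infty$. 9. If $T$ is as in 8,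 $r\in\mathbb Q^+$, $\beta<\alpha$, $t,t'\in T(\beta)$, $s\in T(\alpha)$, $t\subset s$, then there is $s'\in T(\alpha)$ with $t'\subset s'$ and $\sum(s,s')<\sum(t,t')+r$. Let $\mathbb P_{\mathfrak T}$ be the set of all finite tuples $\langle t_0,\dots,t_n\rangle$ with $t_i\in T_i$ for $i\le n$ and $t_i=\mathfrak f(t_{i+1})$ for $i<n$. An *isomorphism* of $\mathfrak T$ onto an embrion $\mathfrak T'$ of the same height is a sequence $h=(h_n)_{n\in\omega}$ of order isomorphisms $h_n:T_n\to T'_n$ such that for all $n$ and $t\in T_n$ the map $h_{n+1}$ sends $T\langle t\rangle$ onto $T'\langle h_n(t)\rangle$. Put $h\cdot\langle t_0,\dots,t_n\rangle=\langle h_0(t_0),\dots,h_n(t_n)\rangle$. **Theorem.** Let $\lambda<\omega_1$ be a limit ordinal, let $\mathfrak T,\mathfrak T'$ be embrions of height $\lambda+1$, and let $\mathbf t=\langle t_0,\dots,t_n\rangle\in\mathbb P_{\mathfrak T}$ and $\mathbf t'=\langle t'_0,\dots,t'_n\rangle\in\mathbb P_{\mathfrak T'}$ be conditions with the same number of components and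 $|t_0|=|t_0'|$. Then $|t_k|=|t'_k|$ and $|t_k|+k=|t_0|$ for all $k\le n$, and there is an isomorphism $h$ of $\mathfrak T$ onto $\mathfrak T'$ such that $h\cdot\mathbf t=\mathbf t'$. -/

import Mathlib

open scoped Ordinal

/-! ### Transfinite sequences of positive rationals -/

/-- The positive rationals. -/
abbrev PosRat : Type := {q : ℚ // 0 < q}

/-- A transfinite sequence of positive rationals of length `len`. The values at the arguments below
`len` are positive; outside of the domain `val` is set to `0`, so that equality of such objects is
equality of sequences. -/
@[ext]
structure PSeq : Type 1 where
  len : Ordinal.{0}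
  val : Ordinal.{0} → ℚ
  pos : ∀ γ, γ < len → 0 < val γ
  junk : ∀ γ, len ≤ γ → val γ = 0

namespace PSeq

/-- Sequences are ordered by extension. -/
instance : PartialOrder PSeq where
  le s t := s.len ≤ t.len ∧ ∀ γ, γ < s.len → s.val γ = t.val γ
  le_refl s := ⟨le_rfl, fun _ _ => rfl⟩
  le_trans s t u hst htu :=
    ⟨hst.1.trans htu.1, fun γ h => (hst.2 γ h).trans (htu.2 γ (h.trans_le hst.1))⟩
  le_antisymm s t hst hts := by
    have hl : s.len = t.len := le_antisymm hst.1 hts.1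
    refine PSeq.ext hl (funext fun γ => ?_)
    by_cases h : γ < s.len
    · exact hst.2 γ h
    · rw [s.junk γ (not_lt.1 h), t.junk γ (hl ▸ not_lt.1 h)]

/-- The restriction `s ↾ α`. -/
noncomputable def restrict (s : PSeq) (α : Ordinal.{0}) : PSeq where
  len := min s.len α
  val γ := by classical exact if γ < α then s.val γ else 0
  pos γ h := by
    have h2 := lt_min_iff.1 h
    simpa [h2.2] using s.pos γ h2.1
  junk γ h := by
    by_cases h2 : γ < α
    · have : s.len ≤ γ := by
        rcases min_le_iff.1 h with h3 | h3
        · exact h3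
        · exact absurd h2 (not_lt.2 h3)
      simpa [h2] using s.junk γ this
    · simp [h2]

/-- The empty sequence. -/
def nil : PSeq where
  len := 0
  val _ := 0
  pos γ h := absurd h (not_lt.2 (zero_le (a := γ)))
  junk _ _ := rfl

/-- The extension of `s` by the rightmost term `q`. -/
noncomputable def snoc (s : PSeq) (q : PosRat) : PSeq where
  len := s.len + 1
  val γ := by classical exact if γ = s.len then q.1 else s.val γ
  pos γ h := by
    by_cases h2 : γ = s.len
    · simpa [h2] using q.2
    · have h3 : γ ≤ s.len := Order.lt_add_one_iff.1 h
      simpa [h2] using s.pos γ (lt_of_le_of_ne h3 h2)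
  junk γ h := by
    have h2 : s.len < γ := Order.add_one_le_iff.1 h
    simpa [h2.ne'] using s.junk γ h2.le

/-- The distance `∑_{γ < |s|} |s_γ - t_γ|`, for sequences of the same length: the supremum of
the finite partial sums, in `[0, ∞]`. -/
noncomputable def dist (s t : PSeq) : ENNReal :=
  ∑' γ : Set.Iio s.len, ENNReal.ofReal ((|s.val γ.1 - t.val γ.1| : ℚ) : ℝ)

end PSeq

/-! ### Normal trees -/

/-- The level `T(α)`. -/
def level (T : Set PSeq) (α : Ordinal.{0}) : Set PSeq := {t | t ∈ T ∧ t.len = α}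

/-- The restriction of `T` to the levels below `α`. -/
def below (T : Set PSeq) (α : Ordinal.{0}) : Set PSeq := {t | t ∈ T ∧ t.len < α}

/-- `T` is a normal `α`-tree. Levels are counted from `1`. The omitted root (the empty sequence)
is treated as a non-maximal node with infinitely many immediate successors if `1 < α`. -/
structure IsNormalTree (T : Set PSeq) (α : Ordinal.{0}) : Prop where
  one_le : 1 ≤ α
  le_omega_one : α ≤ ω₁
  len_ne_zero : ∀ t ∈ T, t.len ≠ 0
  restrict_mem : ∀ t ∈ T, ∀ β, 1 ≤ β → β < t.len → t.restrict β ∈ T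
  root_infinite : 1 < α → (level T 1).Infinite
  succ_infinite : ∀ t ∈ T, (∃ s ∈ T, t < s) →
    {s | s ∈ T ∧ t < s ∧ s.len = t.len + 1}.Infinite
  level_countable : ∀ β, (level T β).Countable
  height : IsLeast {β | 0 < β ∧ ∀ t ∈ T, t.len < β} α
  exists_above : ∀ t ∈ T, ∀ β, t.len < β → β < α → ∃ s ∈ level T β, t < s

/-- A recursive partition of the positive rationals into countably many dense sets. -/
structure IsRatPartition (Q : ℕ → Set PosRat) : Prop where
  disjoint : ∀ m n, m ≠ n → Disjoint (Q m) (Q n)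
  cover : ⋃ n, Q n = Set.univ
  dense : ∀ n, Dense (Q n)
  recursive : ComputablePred fun x : ℕ × ℕ × ℕ =>
    ∃ h : 0 < (x.2.1 : ℚ) / (x.2.2 : ℚ), (⟨(x.2.1 : ℚ) / (x.2.2 : ℚ), h⟩ : PosRat) ∈ Q x.1

/-! ### The constructible hierarchy and set theory without the power set axiom -/

/-- The only symbol of the language of set theory besides equality. -/
inductive MemSymbol : ℕ → Type
  | mem : MemSymbol 2

/-- The first-order language of set theory. -/
def setLang : FirstOrder.Language.{0, 0} := ⟨fun _ => Empty, MemSymbol⟩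

/-- A class of sets as a structure with the true membership relation. -/
instance memStructure (M : Set ZFSet.{0}) : setLang.Structure M where
  funMap f := Empty.elim f
  RelMap r := match r with
    | MemSymbol.mem => fun v => (v 0).1 ∈ (v 1).1

/-- The levels `L_α` of the constructible hierarchy: `L_α` is the union, over `β < α`, of the
families of all subsets of `L_β` that are first-order definable over `L_β` with parameters. -/
def constr (α : Ordinal.{0}) : Set ZFSet.{0} :=
  {x | ∃ β, ∃ _ : β < α, (∀ z ∈ x, z ∈ constr β) ∧
    (Set.univ : Set (constr β)).Definable₁ setLang {z : constr β | z.1 ∈ x}}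
termination_by α

/-- `(M, ∈)` satisfies `ZFC` without the power set axiom. The two schemata are stated by
quantifying over the sets and relations definable over `M` with parameters. -/
structure ModelsZFCMinus (M : Set ZFSet.{0}) : Prop where
  extensionality : ∀ x y : M, (∀ z : M, z.1 ∈ x.1 ↔ z.1 ∈ y.1) → x = y
  foundation : ∀ x : M, (∃ y : M, y.1 ∈ x.1) →
    ∃ y : M, y.1 ∈ x.1 ∧ ∀ z : M, z.1 ∈ x.1 → z.1 ∉ y.1
  pairing : ∀ x y : M, ∃ z : M, ∀ w : M, w.1 ∈ z.1 ↔ w = x ∨ w = y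
  union : ∀ x : M, ∃ u : M, ∀ z : M, z.1 ∈ u.1 ↔ ∃ y : M, y.1 ∈ x.1 ∧ z.1 ∈ y.1
  infinity : ∃ x : M, (∃ e : M, e.1 ∈ x.1 ∧ ∀ z : M, z.1 ∉ e.1) ∧
    ∀ y : M, y.1 ∈ x.1 → ∃ z : M, z.1 ∈ x.1 ∧ ∀ w : M, w.1 ∈ z.1 ↔ w.1 ∈ y.1 ∨ w = y
  separation : ∀ S : Set M, Set.univ.Definable₁ setLang S →
    ∀ x : M, ∃ y : M, ∀ z : M, z.1 ∈ y.1 ↔ z.1 ∈ x.1 ∧ z ∈ S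
  collection : ∀ R : Set (M × M), Set.univ.Definable₂ setLang R →
    ∀ x : M, (∀ z : M, z.1 ∈ x.1 → ∃ w : M, (z, w) ∈ R) →
      ∃ y : M, ∀ z : M, z.1 ∈ x.1 → ∃ w : M, w.1 ∈ y.1 ∧ (z, w) ∈ R
  choice : ∀ x : M, (∀ y : M, y.1 ∈ x.1 → ∃ z : M, z.1 ∈ y.1) →
    (∀ y y' z : M, y.1 ∈ x.1 → y'.1 ∈ x.1 → z.1 ∈ y.1 → z.1 ∈ y'.1 → y = y') →
      ∃ c : M, ∀ y : M, y.1 ∈ x.1 → ∃! z : M, z.1 ∈ y.1 ∧ z.1 ∈ c.1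

/-- A positive rational as a set: the pair of its numerator and denominator. -/
noncomputable def codeRat (q : ℚ) : ZFSet.{0} :=
  ZFSet.pair (Ordinal.toZFSet (q.num.natAbs : Ordinal.{0})) (Ordinal.toZFSet (q.den : Ordinal.{0}))

/-- A sequence as a set: the set of the pairs `(γ, s_γ)` for `γ < |s|`. -/
noncomputable def PSeq.code (s : PSeq) : ZFSet.{0} :=
  ZFSet.range fun γ : Set.Iio s.len => ZFSet.pair (Ordinal.toZFSet γ.1) (codeRat (s.val γ.1))

/-- The set `x` is the set of sequences `A`. -/
def IsCode (x : ZFSet.{0}) (A : Set PSeq) : Prop := ∀ z, z ∈ x ↔ ∃ s ∈ A, s.code = z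

/-- The set `x` is the sequence of sets of sequences `A n`. -/
def IsSeqCode (x : ZFSet.{0}) (A : ℕ → Set PSeq) : Prop :=
  ∀ z, z ∈ x ↔ ∃ (n : ℕ) (y : ZFSet.{0}),
    IsCode y (A n) ∧ z = ZFSet.pair (Ordinal.toZFSet (n : Ordinal.{0})) y

/-- The set `x` is the map `t ↦ F t` on the domain `A`. -/
def IsMapCode (x : ZFSet.{0}) (A : Set PSeq) (F : PSeq → Set PSeq) : Prop :=
  ∀ z, z ∈ x ↔ ∃ t ∈ A, ∃ y : ZFSet.{0}, IsCode y (F t) ∧ z = ZFSet.pair t.code y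

/-- The ordinal `α` is countable in `M`: some element of `M` is a map of `ω` onto `α`. -/
def CountableIn (M : Set ZFSet.{0}) (α : Ordinal.{0}) : Prop :=
  ∃ f ∈ M, ZFSet.IsFunc (Ordinal.toZFSet ω) (Ordinal.toZFSet α) f ∧
    ∀ z ∈ Ordinal.toZFSet α, ∃ k ∈ Ordinal.toZFSet ω, ZFSet.pair k z ∈ f

/-- `L_θ` (with `θ < ω₁`) models `ZFC` minus power set, `α` is countable in `L_θ`, and both the
sequence of the trees `T n` restricted below `α` and the map `F` on them belong to `L_θ`. -/
def IsSuitable (T : ℕ → Set PSeq) (F : PSeq → Set PSeq) (α θ : Ordinal.{0}) : Prop :=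
  θ < ω₁ ∧ ModelsZFCMinus (constr θ) ∧ CountableIn (constr θ) α ∧
    (∃ x ∈ constr θ, IsSeqCode x fun n => below (T n) α) ∧
    (∃ x ∈ constr θ, IsMapCode x (⋃ n, below (T n) α) F)

/-- `D` is a pre-dense subset of the tree `T`: every element of `T` is compatible (that is,
comparable) with an element of `D`. -/
def IsPredense (D T : Set PSeq) : Prop := D ⊆ T ∧ ∀ t ∈ T, ∃ s ∈ D, s ≤ t ∨ t ≤ s

/-! ### Embrions -/

/-- The cofinal branches, of length `α`, through `S` that belong to `T`. -/
def branches (T S : Set PSeq) (α : Ordinal.{0}) : Set PSeq :=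
  {s | s ∈ level T α ∧ ∀ γ, 1 ≤ γ → γ < α → s.restrict γ ∈ S}

/-- An embrion of height `μ`: normal `μ`-trees `tree n` together with a map sending `t ∈ tree n` to
a subtree `sub t` of `tree (n + 1)` (the values of `sub` outside of the trees are irrelevant). -/
structure Embrion (Q : ℕ → Set PosRat) (μ : Ordinal.{0}) where
  tree : ℕ → Set PSeq
  sub : PSeq → Set PSeq
  normal : ∀ n, IsNormalTree (tree n) μ
  level_one : 1 < μ → ∀ n, level (tree n) 1 = {t | ∃ q ∈ Q n, t = PSeq.nil.snoc q}
  snoc_mem : ∀ n, ∀ t ∈ tree n, t.len + 1 < μ → ∀ q, t.snoc q ∈ tree n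
  sub_subset : ∀ n, ∀ t ∈ tree n, sub t ⊆ tree (n + 1)
  sub_normal : ∀ n, ∀ t ∈ tree n, IsNormalTree (sub t) t.len
  /-- The subtrees cover `tree (n + 1)`, except for its maximal level (if there is one). -/
  sub_cover : ∀ n, ⋃ t ∈ tree n, sub t = {s | s ∈ tree (n + 1) ∧ s.len + 1 < μ}
  sub_coherent : ∀ n, ∀ t ∈ tree n, ∀ t₁ ∈ tree n, t < t₁ → sub t = below (sub t₁) t.len
  sub_inter : ∀ n, ∀ t ∈ tree n, t.len + 1 < μ → ∀ q₁ q₂, q₁ ≠ q₂ →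
    sub (t.snoc q₁) ∩ sub (t.snoc q₂) = sub t
  /-- The projection `s ↦ t` from `tree (n + 1)` to `tree n` is well defined. -/
  sub_unique : ∀ n, ∀ s ∈ tree (n + 1), s.len + 1 < μ →
    ∃! t, t ∈ level (tree n) (s.len + 1) ∧ s ∈ sub t
  /-- At a limit level, each `s ∈ tree (n + 1)` is a branch through `sub t` for some `t ∈ tree n`
  of the same length. Below the maximal level of the trees this follows from the above. -/
  limit_cover : ∀ n lam, Order.IsSuccLimit lam → lam < μ → ∀ s ∈ level (tree (n + 1)) lam,
    ∃ t ∈ level (tree n) lam, s ∈ branches (tree (n + 1)) (sub t) lam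
  /-- At a limit level, each `sub t` together with its branches is normal. Below the maximal
  level of the trees this follows from the above. -/
  limit_normal : ∀ n lam, Order.IsSuccLimit lam → lam < μ → ∀ t ∈ level (tree n) lam,
    IsNormalTree (sub t ∪ branches (tree (n + 1)) (sub t) lam) (lam + 1)
  /-- Elements of limit levels are generic over the least suitable `L_θ`. -/
  generic : ∀ lam, Order.IsSuccLimit lam → lam < μ →
    ∀ θ, IsLeast {θ | IsSuitable tree sub lam θ} θ →
      ∀ n, ∀ D : Set PSeq, IsPredense D (below (tree n) lam) →
        (∃ x ∈ constr θ, IsCode x D) → ∀ t ∈ level (tree n) lam, ∃ s ∈ D, s < t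
  sum_lt : ∀ T : Set PSeq, (T = tree 0 ∨ ∃ n, ∃ u ∈ tree n, T = sub u) →
    ∀ α lam, Order.IsSuccLimit lam → α < lam → ∀ s ∈ level T lam, ∀ t ∈ level T lam, s ≠ t →
      (s.restrict α).dist (t.restrict α) < s.dist t ∧ s.dist t < ⊤
  regular : ∀ T : Set PSeq, (T = tree 0 ∨ ∃ n, ∃ u ∈ tree n, T = sub u) →
    ∀ (r : PosRat) (α β : Ordinal.{0}), β < α →
      ∀ t ∈ level T β, ∀ t' ∈ level T β, ∀ s ∈ level T α, t < s →
        ∃ s' ∈ level T α, t' < s' ∧ s.dist s' < t.dist t' + ENNReal.ofReal ((r.1 : ℚ) : ℝ)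

namespace Embrion

variable {Q : ℕ → Set PosRat} {μ : Ordinal.{0}}

/-- The conditions `⟨t_0, …, t_n⟩` with `n + 1` components: `t_i ∈ tree i`, and `t_i` is the
projection of `t_{i+1}`, that is, the element of `tree i` of length `|t_{i+1}| + 1` such that
`t_{i+1} ∈ sub t_i`. -/
structure Condition (E : Embrion Q μ) (n : ℕ) where
  val : (i : Fin (n + 1)) → E.tree i
  proj : ∀ i : Fin n, (val i.castSucc).1.len = (val i.succ).1.len + 1 ∧
    (val i.succ).1 ∈ E.sub (val i.castSucc).1

/-- Isomorphisms of embrions: order isomorphisms of the trees such that the one of `tree (n + 1)`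
maps the subtree `sub t` onto the subtree of the image of `t`, for each `t ∈ tree n`. -/
structure Iso (E E' : Embrion Q μ) where
  map : ∀ n, E.tree n ≃o E'.tree n
  map_sub : ∀ n (t : E.tree n),
    {s | ∃ u : E.tree (n + 1), u.1 ∈ E.sub t.1 ∧ (map (n + 1) u).1 = s} = E'.sub (map n t).1

/-- The action of an isomorphism on a condition. -/
def Iso.act {E E' : Embrion Q μ} (h : Iso E E') {n : ℕ} (t : E.Condition n) :
    (i : Fin (n + 1)) → E'.tree i :=
  fun i => h.map i (t.val i)

end Embrion

/-! Every node lies below a node of level `lam`, so an isomorphism is determined by its action on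
top branches. A bijection of top levels induces a tree isomorphism once it preserves how far any two
branches agree. It also respects `sub` provided each matched pair in tree `n + 1` runs through `sub
t` and `sub t'` for some matched pair `t`, `t'` in tree `n`: by uniqueness of the projection, a node
`u` of such a branch, with `u.len < lam`, lies in `sub v` exactly when `t.restrict (u.len + 1) ≤ v`
(`mem_sub_iff`), a condition on the order of tree `n` alone.

Such a bijection comes from back and forth between the countable top levels (`exists_isTopIso`),
starting from chains of top branches through the two conditions. To match a new branch, its
projection is matched first, and a partner is then sought inside the corresponding subtree
(`exists_extension`). Infinite splitting lets the partner leave all earlier branches at the right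
node (`exists_matching_branch`). -/

namespace PSeq

/-! ### Restrictions and agreement of sequences -/

@[simp] theorem restrict_len (s : PSeq) (α : Ordinal.{0}) : (s.restrict α).len = min s.len α := rfl

theorem restrict_val (s : PSeq) {α γ : Ordinal.{0}} (h : γ < α) :
    (s.restrict α).val γ = s.val γ := by
  simp [restrict, h]

theorem restrict_le (s : PSeq) (α : Ordinal.{0}) : s.restrict α ≤ s :=
  ⟨min_le_left _ _, fun _ h => restrict_val s (lt_min_iff.1 h).2⟩

theorem eq_of_le_of_len_le {s t : PSeq} (h : s ≤ t) (hl : t.len ≤ s.len) : s = t :=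
  le_antisymm h ⟨hl, fun γ hγ => (h.2 γ (hγ.trans_le hl)).symm⟩

theorem restrict_of_len_le {s : PSeq} {α : Ordinal.{0}} (h : s.len ≤ α) : s.restrict α = s :=
  eq_of_le_of_len_le (restrict_le s α) (le_min le_rfl h)

theorem restrict_of_le {s t : PSeq} (h : s ≤ t) : t.restrict s.len = s := by
  symm
  refine eq_of_le_of_len_le ⟨le_min h.1 le_rfl, fun γ hγ => ?_⟩ (min_le_right _ _)
  rw [restrict_val t hγ, h.2 γ hγ]

theorem restrict_restrict (s : PSeq) {α β : Ordinal.{0}} (h : β ≤ α) :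
    (s.restrict α).restrict β = s.restrict β := by
  refine PSeq.ext (by simp [min_assoc, min_eq_right h]) (funext fun γ => ?_)
  by_cases hγ : γ < β
  · rw [restrict_val _ hγ, restrict_val _ hγ, restrict_val _ (hγ.trans_le h)]
  · rw [junk _ γ ((min_le_right _ _).trans (not_lt.1 hγ)),
      junk _ γ ((min_le_right _ _).trans (not_lt.1 hγ))]

theorem restrict_eq_of_le {s t : PSeq} {α β : Ordinal.{0}} (h : β ≤ α)
    (hst : s.restrict α = t.restrict α) : s.restrict β = t.restrict β := by
  rw [← restrict_restrict s h, hst, restrict_restrict t h]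

theorem restrict_zero (s : PSeq) : s.restrict 0 = nil :=
  PSeq.ext (by simp [nil]) (funext fun γ => by
    rw [junk _ γ ((min_le_right _ _).trans (zero_le (a := γ)))]; rfl)

theorem restrict_len_of_le {s : PSeq} {α : Ordinal.{0}} (h : α ≤ s.len) :
    (s.restrict α).len = α := min_eq_right h

theorem restrict_le_restrict_iff {s t : PSeq} {α β : Ordinal.{0}} (hs : α ≤ s.len)
    (ht : β ≤ t.len) :
    s.restrict α ≤ t.restrict β ↔ α ≤ β ∧ s.restrict α = t.restrict α := by
  constructor
  · intro h
    have hl : α ≤ β := by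
      have := h.1
      rwa [restrict_len_of_le hs, restrict_len_of_le ht] at this
    refine ⟨hl, ?_⟩
    have := restrict_of_le h
    rw [restrict_len_of_le hs, restrict_restrict _ hl] at this
    exact this.symm
  · rintro ⟨hl, h⟩
    rw [h, ← restrict_restrict t hl]
    exact restrict_le _ _

/-- Distinct sequences of the same length agree exactly up to some `δ`. -/
theorem exists_restrict_eq_iff {s t : PSeq} (hl : s.len = t.len) (hne : s ≠ t) :
    ∃ δ < s.len, ∀ γ, s.restrict γ = t.restrict γ ↔ γ ≤ δ := by
  have hex : {γ | s.val γ ≠ t.val γ}.Nonempty := by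
    by_contra h
    refine hne (PSeq.ext hl (funext fun γ => ?_))
    by_contra h2
    exact h ⟨γ, h2⟩
  have hmem : s.val (sInf _) ≠ t.val (sInf _) := csInf_mem hex
  -- The first place of disagreement. It lies below the common length because both sequences are `0`
  -- beyond it.
  refine ⟨sInf {γ | s.val γ ≠ t.val γ}, ?_, fun γ => ⟨fun h => ?_, fun h => ?_⟩⟩
  · by_contra h
    rw [not_lt] at h
    exact hmem (by rw [junk _ _ h, junk _ _ (hl ▸ h)])
  · by_contra h2
    rw [not_le] at h2
    exact hmem (by rw [← restrict_val s h2, h, restrict_val t h2])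
  · refine PSeq.ext (by simp [hl]) (funext fun β => ?_)
    by_cases hβ : β < γ
    · rw [restrict_val _ hβ, restrict_val _ hβ]
      by_contra h2
      exact (hβ.trans_le h).not_ge (csInf_le' h2)
    · rw [junk _ _ ((min_le_right _ _).trans (not_lt.1 hβ)),
        junk _ _ ((min_le_right _ _).trans (not_lt.1 hβ))]

end PSeq

open PSeq

/-! ### Branches in normal trees of successor height -/

namespace IsNormalTree

variable {T : Set PSeq} {lam : Ordinal.{0}}

theorem one_le_len {μ : Ordinal.{0}} (hT : IsNormalTree T μ) {t : PSeq} (ht : t ∈ T) : 1 ≤ t.len :=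
  Order.one_le_iff_pos.2 (pos_iff_ne_zero.2 (hT.len_ne_zero t ht))

theorem len_lt {μ : Ordinal.{0}} (hT : IsNormalTree T μ) {t : PSeq} (ht : t ∈ T) : t.len < μ :=
  hT.height.1.2 t ht

theorem restrict_mem_of_le {μ : Ordinal.{0}} (hT : IsNormalTree T μ) {t : PSeq} (ht : t ∈ T)
    {β : Ordinal.{0}} (h1 : 1 ≤ β) : t.restrict β ∈ T := by
  rcases lt_or_ge β t.len with h | h
  · exact hT.restrict_mem t ht β h1 h
  · rwa [restrict_of_len_le h]

theorem exists_top (hT : IsNormalTree T (lam + 1)) {t : PSeq} (ht : t ∈ T) :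
    ∃ s ∈ level T lam, t ≤ s := by
  rcases (Order.lt_add_one_iff.1 (hT.len_lt ht)).lt_or_eq with h | h
  · obtain ⟨s, hs, hts⟩ := hT.exists_above t ht lam h (Order.lt_add_one_iff.2 le_rfl)
    exact ⟨s, hs, hts.le⟩
  · exact ⟨t, ⟨ht, h⟩, le_rfl⟩

/-- Above each node there is a maximal one that leaves finitely many given branches at once. -/
theorem exists_top_avoiding (hT : IsNormalTree T (lam + 1)) {p : PSeq}
    (hp : p = nil ∨ p ∈ T) (hpl : p.len < lam) {A : Set PSeq} (hA : A.Finite) :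
    ∃ s ∈ level T lam, p ≤ s ∧ ∀ y ∈ A, s.restrict (p.len + 1) ≠ y.restrict (p.len + 1) := by
  have hsucc : {v | v ∈ T ∧ p ≤ v ∧ v.len = p.len + 1}.Infinite := by
    rcases hp with rfl | hp
    · refine (hT.root_infinite ?_).mono ?_
      · exact lt_of_le_of_lt (Order.one_le_iff_pos.2 (hpl.trans_le' zero_le))
          (Order.lt_add_one_iff.2 le_rfl)
      · rintro v ⟨hv, hl⟩
        exact ⟨hv, ⟨zero_le, fun γ h => absurd h (not_lt.2 zero_le)⟩, by
          rw [hl]; exact (zero_add 1).symm⟩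
    · obtain ⟨s, hs, hps⟩ := hT.exists_above p hp lam hpl (Order.lt_add_one_iff.2 le_rfl)
      exact (hT.succ_infinite p hp ⟨s, hs.1, hps⟩).mono fun v hv => ⟨hv.1, hv.2.1.le, hv.2.2⟩
  -- Only finitely many successors of `p` lie on branches of `A`, so some successor `v` is on none
  -- of them.
  obtain ⟨v, ⟨hv, hpv, hvl⟩, hvA⟩ :=
    hsucc.exists_notMem_finite (hA.image fun y => y.restrict (p.len + 1))
  obtain ⟨s, hs, hvs⟩ := hT.exists_top hv
  refine ⟨s, hs, hpv.trans hvs, fun y hy h => hvA ⟨y, hy, ?_⟩⟩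
  rw [← restrict_of_le hvs, hvl]
  exact h.symm

end IsNormalTree

/-- One step of the back and forth construction: a finite set of pairs of branches, with the
same pattern of agreement on both sides, extends to one more branch. -/
theorem exists_matching_branch {S : Set PSeq} {lam : Ordinal.{0}}
    (hS : IsNormalTree S (lam + 1)) (hlim : Order.IsSuccLimit lam) {P : Set (PSeq × PSeq)}
    (hP : P.Finite) (hlen : ∀ p ∈ P, p.1.len = lam ∧ p.2.len = lam)
    (hagree : ∀ p ∈ P, ∀ q ∈ P, ∀ γ,
      p.1.restrict γ = q.1.restrict γ ↔ p.2.restrict γ = q.2.restrict γ)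
    {s : PSeq} (hs : s.len = lam) (hnew : ∀ p ∈ P, s ≠ p.1)
    (hmem : ∀ p ∈ P, ∀ γ, 1 ≤ γ → γ < lam → s.restrict γ = p.1.restrict γ → p.2.restrict γ ∈ S) :
    ∃ s' ∈ level S lam, ∀ p ∈ P, ∀ γ,
      s.restrict γ = p.1.restrict γ ↔ s'.restrict γ = p.2.restrict γ := by
  rcases P.eq_empty_or_nonempty with rfl | hne
  · obtain ⟨s', hs', -⟩ := hS.exists_top_avoiding (Or.inl rfl)
      (show nil.len < lam from pos_iff_ne_zero.2 hlim.ne_bot) Set.finite_empty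
    exact ⟨s', hs', fun p hp => absurd hp (Set.notMem_empty p)⟩
  have hΔ : ∀ p : PSeq × PSeq, ∃ δ, p ∈ P →
      δ < lam ∧ ∀ γ, s.restrict γ = p.1.restrict γ ↔ γ ≤ δ := by
    intro p
    by_cases hp : p ∈ P
    · obtain ⟨δ, hδ, h⟩ := exists_restrict_eq_iff (hs.trans (hlen p hp).1.symm) (hnew p hp)
      exact ⟨δ, fun _ => ⟨hs ▸ hδ, h⟩⟩
    · exact ⟨0, fun h => absurd h hp⟩
  choose Δ hΔ using hΔ
  -- Among the old branches, `x.1` shares the longest initial segment with `s`; the partner of `s`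
  -- has to leave all targets right after the corresponding segment of `x.2`.
  obtain ⟨x, hx, hmax⟩ := Set.exists_max_image P Δ hP hne
  obtain ⟨hδ, hsx⟩ := hΔ x hx
  have hpl : (x.2.restrict (Δ x)).len = Δ x := restrict_len_of_le ((hlen x hx).2 ▸ hδ.le)
  obtain ⟨s', hs', hle, havoid⟩ := hS.exists_top_avoiding (p := x.2.restrict (Δ x))
    (by
      -- If `Δ x = 0`, the splitting node is the omitted root, which is not in `S`.
      rcases eq_or_ne (Δ x) 0 with h | h
      · exact Or.inl (by rw [h, restrict_zero])
      · exact Or.inr (hmem x hx _ (Order.one_le_iff_pos.2 (pos_iff_ne_zero.2 h)) hδ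
          ((hsx _).2 le_rfl)))
    (by rwa [hpl]) (hP.image Prod.snd)
  rw [hpl] at havoid
  have hs'x : s'.restrict (Δ x) = x.2.restrict (Δ x) := by
    have := restrict_of_le hle
    rwa [hpl] at this
  refine ⟨s', hs', fun y hy γ => ?_⟩
  -- Up to `Δ x`, `s` and `s'` coincide with `x.1` and `x.2`, so the old pattern applies. Beyond it,
  -- maximality on one side and avoidance on the other make both agreements false.
  rcases le_or_gt γ (Δ x) with h | h
  · rw [restrict_eq_of_le h hs'x, (hsx γ).2 h]
    exact hagree x hx y hy γ
  · refine iff_of_false (fun h2 => ?_) (fun h2 => ?_)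
    · exact (((hΔ y hy).2 γ).1 h2).not_gt ((hmax y hy).trans_lt h)
    · exact havoid y.2 ⟨y, hy, rfl⟩ (restrict_eq_of_le (Order.add_one_le_iff.2 h) h2)

/-- A relation that is total on both sides and preserves the order in both directions is the
graph of an order isomorphism. -/
theorem exists_orderIso_of_relation {α β : Type*} [PartialOrder α] [PartialOrder β]
    (R : α → β → Prop) (hl : ∀ a, ∃ b, R a b) (hr : ∀ b, ∃ a, R a b)
    (hle : ∀ a b a' b', R a b → R a' b' → (a ≤ a' ↔ b ≤ b')) :
    ∃ e : α ≃o β, ∀ a, R a (e a) := by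
  choose f hf using hl
  choose g hg using hr
  have hfl : ∀ a a', f a ≤ f a' ↔ a ≤ a' := fun a a' => (hle _ _ _ _ (hf a) (hf a')).symm
  refine ⟨⟨⟨f, g, fun a => ?_, fun b => ?_⟩, hfl _ _⟩, hf⟩
  · exact le_antisymm ((hle _ _ _ _ (hg _) (hf a)).2 le_rfl)
      ((hle _ _ _ _ (hf a) (hg _)).2 le_rfl)
  · exact le_antisymm ((hle _ _ _ _ (hf _) (hg b)).1 le_rfl)
      ((hle _ _ _ _ (hg b) (hf _)).1 le_rfl)

/-! ### Membership in the subtrees -/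

namespace Embrion

variable {Q : ℕ → Set PosRat} {lam : Ordinal.{0}}

theorem sub_mono {μ : Ordinal.{0}} (E : Embrion Q μ) {n : ℕ} {t t₁ : PSeq} (ht : t ∈ E.tree n)
    (ht₁ : t₁ ∈ E.tree n) (h : t ≤ t₁) : E.sub t ⊆ E.sub t₁ := by
  rcases h.lt_or_eq with h | rfl
  · rw [E.sub_coherent n t ht t₁ ht₁ h]
    exact fun _ hs => hs.1
  · exact subset_rfl

theorem mem_sub_restrict {μ : Ordinal.{0}} (E : Embrion Q μ) {n : ℕ} {t u : PSeq}
    (ht : t ∈ E.tree n) (hu : u ∈ E.sub t) : u ∈ E.sub (t.restrict (u.len + 1)) := by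
  have hlt := (E.sub_normal n t ht).len_lt hu
  rcases (Order.add_one_le_iff.2 hlt).lt_or_eq with h | h
  · have hr := (E.normal n).restrict_mem t ht (u.len + 1) le_add_self h
    have hl : (t.restrict (u.len + 1)).len = u.len + 1 := restrict_len_of_le h.le
    rw [E.sub_coherent n _ hr t ht ((restrict_le _ _).lt_of_ne fun h2 => by
      rw [h2] at hl; exact h.ne hl.symm)]
    exact ⟨hu, by rw [hl]; exact Order.lt_add_one_iff.2 le_rfl⟩
  · rwa [restrict_of_len_le h.ge]

/-- The projection of `u` is `w.restrict (u.len + 1)` by uniqueness, and coherence makes the nodes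
whose subtrees contain `u` exactly those extending it. This turns questions about `sub` into
questions about order. -/
theorem mem_sub_iff (E : Embrion Q (lam + 1)) (hlim : Order.IsSuccLimit lam) {n : ℕ}
    {w u t : PSeq} (hw : w ∈ level (E.tree n) lam) (hu : u ∈ E.sub w) (ht : t ∈ E.tree n) :
    u ∈ E.sub t ↔ w.restrict (u.len + 1) ≤ t := by
  have huw := E.mem_sub_restrict hw.1 hu
  have hul : u.len + 1 < lam :=
    hlim.add_one_lt (by simpa only [hw.2] using (E.sub_normal n w hw.1).len_lt hu)
  have hwr : w.restrict (u.len + 1) ∈ E.tree n :=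
    (E.normal n).restrict_mem_of_le hw.1 le_add_self
  constructor
  · intro h
    have hut := E.mem_sub_restrict ht h
    have hlt := Order.add_one_le_iff.2 ((E.sub_normal n t ht).len_lt h)
    have heq := (E.sub_unique n u (E.sub_subset n w hw.1 hu)
      (hul.trans (Order.lt_add_one_iff.2 le_rfl))).unique
      ⟨⟨hwr, restrict_len_of_le (by rw [hw.2]; exact hul.le)⟩, huw⟩
      ⟨⟨(E.normal n).restrict_mem_of_le ht le_add_self, restrict_len_of_le hlt⟩, hut⟩
    rw [heq]
    exact restrict_le _ _
  · exact fun h => E.sub_mono hwr ht h huw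

theorem level_sub_union_branches {μ : Ordinal.{0}} (E : Embrion Q μ) {n : ℕ} {t s : PSeq}
    (ht : t ∈ level (E.tree n) lam)
    (hs : s ∈ level (E.sub t ∪ branches (E.tree (n + 1)) (E.sub t) lam) lam) :
    s ∈ branches (E.tree (n + 1)) (E.sub t) lam := by
  rcases hs.1 with h | h
  · have := (E.sub_normal n t ht.1).len_lt h
    rw [hs.2, ht.2] at this
    exact absurd this (lt_irrefl _)
  · exact h

/-! ### Finite partial isomorphisms and their extension -/

/-- A finite partial isomorphism between the top levels of two embrions: a set of triples
`(n, s, s')`, with `s` and `s'` in the top levels of the `n`-th trees. -/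
structure IsPartialIso (E E' : Embrion Q (lam + 1)) (F : Set (ℕ × PSeq × PSeq)) : Prop where
  finite : F.Finite
  left_mem : ∀ n s s', (n, s, s') ∈ F → s ∈ level (E.tree n) lam
  right_mem : ∀ n s s', (n, s, s') ∈ F → s' ∈ level (E'.tree n) lam
  agree : ∀ n s s' x x', (n, s, s') ∈ F → (n, x, x') ∈ F → ∀ γ,
    s.restrict γ = x.restrict γ ↔ s'.restrict γ = x'.restrict γ
  proj : ∀ n s s', (n + 1, s, s') ∈ F → ∃ t t', (n, t, t') ∈ F ∧
    s ∈ branches (E.tree (n + 1)) (E.sub t) lam ∧ s' ∈ branches (E'.tree (n + 1)) (E'.sub t') lam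

/-- Triples with exchanged sides. -/
def swapTriple (p : ℕ × PSeq × PSeq) : ℕ × PSeq × PSeq := (p.1, p.2.2, p.2.1)

variable {E E' : Embrion Q (lam + 1)} {F : Set (ℕ × PSeq × PSeq)}

namespace IsPartialIso

/-- The clauses are symmetric in the two sides, so only one direction of the back and forth needs an
argument. -/
theorem swap (h : IsPartialIso E E' F) : IsPartialIso E' E (swapTriple ⁻¹' F) where
  finite := h.finite.preimage (Function.Involutive.injective fun _ => rfl).injOn
  left_mem n s s' hs := h.right_mem n s' s hs
  right_mem n s s' hs := h.left_mem n s' s hs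
  agree n s s' x x' hs hx γ := (h.agree n s' s x' x hs hx γ).symm
  proj n s s' hs := by
    obtain ⟨t, t', ht, h1, h2⟩ := h.proj n s' s hs
    exact ⟨t', t, ht, h2, h1⟩

/-- Adding a triple, provided that the target tree for the new value is given. -/
theorem insert_aux (h : IsPartialIso E E' F) (hlim : Order.IsSuccLimit lam) {n : ℕ} {s : PSeq}
    (hs : s ∈ level (E.tree n) lam) {S : Set PSeq} (hS : IsNormalTree S (lam + 1))
    (hST : level S lam ⊆ level (E'.tree n) lam)
    (hnew : ∀ x x', (n, x, x') ∈ F → s ≠ x)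
    (hmem : ∀ x x', (n, x, x') ∈ F → ∀ γ, 1 ≤ γ → γ < lam → s.restrict γ = x.restrict γ →
      x'.restrict γ ∈ S)
    (hproj : ∀ m, n = m + 1 → ∃ t t', (m, t, t') ∈ F ∧ s ∈ branches (E.tree n) (E.sub t) lam ∧
      level S lam ⊆ branches (E'.tree n) (E'.sub t') lam) :
    ∃ s', IsPartialIso E E' (insert (n, s, s') F) := by
  obtain ⟨s', hs', hag⟩ := exists_matching_branch hS hlim (P := {p | (n, p) ∈ F})
    (h.finite.preimage (Prod.mk_right_injective n).injOn)
    (fun p hp => ⟨(h.left_mem _ _ _ hp).2, (h.right_mem _ _ _ hp).2⟩)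
    (fun p hp q hq => h.agree _ _ _ _ _ hp hq) hs.2
    (fun p hp => hnew p.1 p.2 hp) (fun p hp => hmem p.1 p.2 hp)
  refine ⟨s', h.finite.insert _, ?_, ?_, ?_, ?_⟩
  · rintro m x x' (hx | hx)
    · cases hx; exact hs
    · exact h.left_mem m x x' hx
  · rintro m x x' (hx | hx)
    · cases hx; exact hST hs'
    · exact h.right_mem m x x' hx
  · rintro m x x' y y' (hx | hx) (hy | hy) γ
    · cases hx; cases hy; simp
    · cases hx; exact hag (y, y') hy γ
    · cases hy; rw [eq_comm, hag (x, x') hx γ, eq_comm]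
    · exact h.agree m x x' y y' hx hy γ
  · rintro m x x' (hx | hx)
    · cases hx
      obtain ⟨t, t', ht, h1, h2⟩ := hproj m rfl
      exact ⟨t, t', Or.inr ht, h1, h2 hs'⟩
    · obtain ⟨t, t', ht, h1⟩ := h.proj m x x' hx
      exact ⟨t, t', Or.inr ht, h1⟩

/-- Induction on `n`: some `t` with `s` a branch through `sub t` is matched with a `t'` first, and
the partner of `s` is then taken among the branches through `sub t'`. -/
theorem exists_extension (h : IsPartialIso E E' F) (hlim : Order.IsSuccLimit lam) (n : ℕ)
    {s : PSeq} (hs : s ∈ level (E.tree n) lam) :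
    ∃ G, IsPartialIso E E' G ∧ F ⊆ G ∧ ∃ s', (n, s, s') ∈ G := by
  have hlt : lam < lam + 1 := Order.lt_add_one_iff.2 le_rfl
  induction n generalizing s with
  | zero =>
    by_cases hnew : ∃ s', (0, s, s') ∈ F
    · exact ⟨F, h, subset_rfl, hnew⟩
    obtain ⟨s', hs'⟩ := h.insert_aux hlim hs (E'.normal 0) subset_rfl
      (fun x x' hx hsx => hnew ⟨x', hsx ▸ hx⟩)
      (fun x x' hx γ h1 _ _ => (E'.normal 0).restrict_mem_of_le (h.right_mem _ _ _ hx).1 h1)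
      (fun m hm => absurd hm (by omega))
    exact ⟨_, hs', Set.subset_insert _ _, s', Set.mem_insert _ _⟩
  | succ n ih =>
    obtain ⟨t, ht, hst⟩ := E.limit_cover n lam hlim hlt s hs
    obtain ⟨G, hG, hFG, t', ht'⟩ := ih ht
    by_cases hnew : ∃ s', (n + 1, s, s') ∈ G
    · exact ⟨G, hG, hFG, hnew⟩
    have htr := hG.right_mem _ _ _ ht'
    have hbr := fun x hx => E'.level_sub_union_branches htr (s := x) hx
    obtain ⟨s', hs'⟩ := hG.insert_aux hlim hs (E'.limit_normal n lam hlim hlt t' htr)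
      (fun x hx => (hbr x hx).1)
      (fun x x' hx hsx => hnew ⟨x', hsx ▸ hx⟩)
      -- Let `x` run through `sub w`. A common node of `s` and `x` at level `γ` lies in both `sub t`
      -- and `sub w`, so `t` and `w` agree up to `γ + 1`. Hence so do `t'` and `w'`, which puts
      -- `x'.restrict γ` in `sub t'`.
      (fun x x' hx γ h1 h2 heq => by
        obtain ⟨w, w', hw, hxw, hxw'⟩ := hG.proj n x x' hx
        have hwl := hG.left_mem _ _ _ hw
        have hwr := hG.right_mem _ _ _ hw
        have h3 : γ + 1 ≤ lam := Order.add_one_le_iff.2 h2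
        have hl : (x.restrict γ).len = γ := restrict_len_of_le (hxw.1.2 ▸ h2.le)
        have hl' : (x'.restrict γ).len = γ := restrict_len_of_le (hxw'.1.2 ▸ h2.le)
        have h4 := (E.mem_sub_iff hlim hwl (hxw.2 γ h1 h2) ht.1).1 (heq ▸ hst.2 γ h1 h2)
        have h5 := restrict_of_le h4
        rw [hl, restrict_len_of_le (hwl.2 ▸ h3)] at h5
        refine Or.inl ((E'.mem_sub_iff hlim hwr (hxw'.2 γ h1 h2) htr.1).2 ?_)
        rw [hl', ← (hG.agree n t t' w w' ht' hw _).1 h5]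
        exact restrict_le _ _)
      (fun m hm => by
        obtain rfl : n = m := by omega
        exact ⟨t, t', ht', hst, hbr⟩)
    exact ⟨_, hs', hFG.trans (Set.subset_insert _ _), s', Set.mem_insert _ _⟩

theorem exists_extension_right (h : IsPartialIso E E' F) (hlim : Order.IsSuccLimit lam) (n : ℕ)
    {s' : PSeq} (hs' : s' ∈ level (E'.tree n) lam) :
    ∃ G, IsPartialIso E E' G ∧ F ⊆ G ∧ ∃ s, (n, s, s') ∈ G := by
  obtain ⟨G, hG, hFG, s, hs⟩ := h.swap.exists_extension hlim n hs'
  exact ⟨_, hG.swap, fun p hp => hFG hp, s, hs⟩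

end IsPartialIso

/-! ### From partial to total isomorphisms -/

/-- A total isomorphism between the top levels of two embrions. -/
structure IsTopIso (E E' : Embrion Q (lam + 1)) (H : Set (ℕ × PSeq × PSeq)) : Prop where
  left_mem : ∀ n s s', (n, s, s') ∈ H → s ∈ level (E.tree n) lam
  right_mem : ∀ n s s', (n, s, s') ∈ H → s' ∈ level (E'.tree n) lam
  agree : ∀ n s s' x x', (n, s, s') ∈ H → (n, x, x') ∈ H → ∀ γ,
    s.restrict γ = x.restrict γ ↔ s'.restrict γ = x'.restrict γ
  proj : ∀ n s s', (n + 1, s, s') ∈ H → ∃ t t', (n, t, t') ∈ H ∧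
    s ∈ branches (E.tree (n + 1)) (E.sub t) lam ∧ s' ∈ branches (E'.tree (n + 1)) (E'.sub t') lam
  left_total : ∀ n, ∀ s ∈ level (E.tree n) lam, ∃ s', (n, s, s') ∈ H
  right_total : ∀ n, ∀ s' ∈ level (E'.tree n) lam, ∃ s, (n, s, s') ∈ H

/-- Each top node on either side imposes a cofinal requirement on the partial isomorphisms ordered
by inclusion. There are countably many requirements, so an ideal containing `F` meets them all; its
union is `H`. -/
theorem IsPartialIso.exists_isTopIso (h : IsPartialIso E E' F) (hlim : Order.IsSuccLimit lam) :
    ∃ H, F ⊆ H ∧ IsTopIso E E' H := by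
  let X := {G : Set (ℕ × PSeq × PSeq) // IsPartialIso E E' G}
  let I := (Σ n, level (E.tree n) lam) ⊕ (Σ n, level (E'.tree n) lam)
  have : ∀ n, Countable (level (E.tree n) lam) := fun n => (E.normal n).level_countable lam
  have : ∀ n, Countable (level (E'.tree n) lam) := fun n => (E'.normal n).level_countable lam
  have : Encodable I := Encodable.ofCountable I
  let D : I → Order.Cofinal X := fun i => match i with
    | Sum.inl ⟨n, s⟩ => ⟨{G | ∃ s', (n, s.1, s') ∈ G.1}, fun G => by
        obtain ⟨K, hK, hGK, hs⟩ := G.2.exists_extension hlim n s.2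
        exact ⟨⟨K, hK⟩, hs, hGK⟩⟩
    | Sum.inr ⟨n, s'⟩ => ⟨{G | ∃ s, (n, s, s'.1) ∈ G.1}, fun G => by
        obtain ⟨K, hK, hGK, hs⟩ := G.2.exists_extension_right hlim n s'.2
        exact ⟨⟨K, hK⟩, hs, hGK⟩⟩
  let J := Order.idealOfCofinals (⟨F, h⟩ : X) D
  -- Each clause concerns at most two given triples, which directedness places in a single finite
  -- piece.
  have hmem : ∀ p q : ℕ × PSeq × PSeq, p ∈ ⋃ G ∈ J, G.1 → q ∈ ⋃ G ∈ J, G.1 →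
      ∃ G ∈ J, p ∈ G.1 ∧ q ∈ G.1 := by
    intro p q hp hq
    simp only [Set.mem_iUnion] at hp hq
    obtain ⟨G, hG, hp⟩ := hp
    obtain ⟨K, hK, hq⟩ := hq
    obtain ⟨M, hM, hGM, hKM⟩ := J.directed G hG K hK
    exact ⟨M, hM, hGM hp, hKM hq⟩
  have hsub : ∀ G ∈ J, G.1 ⊆ ⋃ G ∈ J, G.1 := fun G hG => Set.subset_biUnion_of_mem
    (s := {G | G ∈ J}) (u := fun G : X => G.1) hG
  refine ⟨⋃ G ∈ J, G.1, hsub _ (Order.mem_idealOfCofinals _ D), ?_, ?_, ?_, ?_, ?_, ?_⟩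
  · intro n s s' hs
    obtain ⟨G, -, hs, -⟩ := hmem _ _ hs hs
    exact G.2.left_mem n s s' hs
  · intro n s s' hs
    obtain ⟨G, -, hs, -⟩ := hmem _ _ hs hs
    exact G.2.right_mem n s s' hs
  · intro n s s' x x' hs hx
    obtain ⟨G, -, hs, hx⟩ := hmem _ _ hs hx
    exact G.2.agree n s s' x x' hs hx
  · intro n s s' hs
    obtain ⟨G, hG, hs, -⟩ := hmem _ _ hs hs
    obtain ⟨t, t', ht, h1⟩ := G.2.proj n s s' hs
    exact ⟨t, t', hsub G hG ht, h1⟩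
  · intro n s hs
    obtain ⟨G, ⟨s', hs'⟩, hG⟩ := Order.cofinal_meets_idealOfCofinals (⟨F, h⟩ : X) D
      (Sum.inl ⟨n, s, hs⟩)
    exact ⟨s', hsub G hG hs'⟩
  · intro n s' hs'
    obtain ⟨G, ⟨s, hs⟩, hG⟩ := Order.cofinal_meets_idealOfCofinals (⟨F, h⟩ : X) D
      (Sum.inr ⟨n, s', hs'⟩)
    exact ⟨s, hsub G hG hs⟩

/-- The relation between the nodes of the `n`-th trees induced by a relation of the top levels. -/
def NodeRel (H : Set (ℕ × PSeq × PSeq)) (lam : Ordinal.{0}) (n : ℕ) (u u' : PSeq) : Prop :=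
  ∃ s s' γ, (n, s, s') ∈ H ∧ γ ≤ lam ∧ u = s.restrict γ ∧ u' = s'.restrict γ

namespace IsTopIso

variable {H : Set (ℕ × PSeq × PSeq)}

/-- The order of two restrictions depends only on their lengths and on the agreement of the
branches. Applied both ways to equal nodes, this also shows that the relation is single-valued and
injective. -/
theorem nodeRel_le_iff (h : IsTopIso E E' H) {n : ℕ} {u u' v v' : PSeq}
    (hu : NodeRel H lam n u u') (hv : NodeRel H lam n v v') : u ≤ v ↔ u' ≤ v' := by
  obtain ⟨s, s', γ, hs, hγ, rfl, rfl⟩ := hu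
  obtain ⟨x, x', δ, hx, hδ, rfl, rfl⟩ := hv
  rw [restrict_le_restrict_iff (by rwa [(h.left_mem _ _ _ hs).2])
      (by rwa [(h.left_mem _ _ _ hx).2]),
    restrict_le_restrict_iff (by rwa [(h.right_mem _ _ _ hs).2])
      (by rwa [(h.right_mem _ _ _ hx).2]), h.agree n s s' x x' hs hx]

theorem nodeRel_mem_sub_iff (h : IsTopIso E E' H) (hlim : Order.IsSuccLimit lam) {n : ℕ}
    {u u' t t' : PSeq} (hu : NodeRel H lam (n + 1) u u') (hut : u ∈ E.tree (n + 1))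
    (ht : NodeRel H lam n t t') (htt : t ∈ E.tree n) (htt' : t' ∈ E'.tree n) :
    u ∈ E.sub t ↔ u' ∈ E'.sub t' := by
  obtain ⟨s, s', γ, hs, hγ, rfl, rfl⟩ := hu
  obtain ⟨w, w', hw, hsw, hsw'⟩ := h.proj n s s' hs
  have hl : (s.restrict γ).len = γ := restrict_len_of_le (by rwa [hsw.1.2])
  have hl' : (s'.restrict γ).len = γ := restrict_len_of_le (by rwa [hsw'.1.2])
  have h1 : 1 ≤ γ := hl ▸ (E.normal (n + 1)).one_le_len hut
  rcases hγ.lt_or_eq with h2 | h2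
  · rw [E.mem_sub_iff hlim (h.left_mem _ _ _ hw) (hsw.2 γ h1 h2) htt,
      E'.mem_sub_iff hlim (h.right_mem _ _ _ hw) (hsw'.2 γ h1 h2) htt', hl, hl']
    exact h.nodeRel_le_iff ⟨w, w', γ + 1, hw, Order.add_one_le_iff.2 h2, rfl, rfl⟩ ht
  -- A node of length `lam` is in no subtree: the elements of `sub t` are shorter than `t`, whose
  -- length is at most `lam`.
  · refine iff_of_false (fun h3 => ?_) (fun h3 => ?_)
    · have := (E.sub_normal n _ htt).len_lt h3
      rw [hl, h2] at this
      exact this.not_ge (Order.lt_add_one_iff.1 ((E.normal n).len_lt htt))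
    · have := (E'.sub_normal n _ htt').len_lt h3
      rw [hl', h2] at this
      exact this.not_ge (Order.lt_add_one_iff.1 ((E'.normal n).len_lt htt'))

theorem exists_orderIso (h : IsTopIso E E' H) (n : ℕ) :
    ∃ e : E.tree n ≃o E'.tree n, ∀ u, NodeRel H lam n u.1 (e u).1 := by
  refine exists_orderIso_of_relation (fun (u : E.tree n) (u' : E'.tree n) =>
    NodeRel H lam n u.1 u'.1) (fun u => ?_) (fun u' => ?_)
    (fun _ _ _ _ hu hv => h.nodeRel_le_iff hu hv)
  · obtain ⟨s, hs, hus⟩ := (E.normal n).exists_top u.2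
    obtain ⟨s', hs'⟩ := h.left_total n s hs
    exact ⟨⟨s'.restrict u.1.len, (E'.normal n).restrict_mem_of_le (h.right_mem _ _ _ hs').1
      ((E.normal n).one_le_len u.2)⟩, s, s', u.1.len, hs', hs.2 ▸ hus.1,
      (restrict_of_le hus).symm, rfl⟩
  · obtain ⟨s', hs', hus⟩ := (E'.normal n).exists_top u'.2
    obtain ⟨s, hs⟩ := h.right_total n s' hs'
    exact ⟨⟨s.restrict u'.1.len, (E.normal n).restrict_mem_of_le (h.left_mem _ _ _ hs).1
      ((E'.normal n).one_le_len u'.2)⟩, s, s', u'.1.len, hs, hs'.2 ▸ hus.1, rfl,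
      (restrict_of_le hus).symm⟩

/-- A total isomorphism of the top levels is induced by an isomorphism of the embrions. -/
theorem exists_iso (h : IsTopIso E E' H) (hlim : Order.IsSuccLimit lam) :
    ∃ e : Iso E E', ∀ n u, NodeRel H lam n u.1 (e.map n u).1 := by
  choose e he using h.exists_orderIso
  refine ⟨⟨e, fun n t => ?_⟩, he⟩
  ext s
  constructor
  · rintro ⟨u, hu, rfl⟩
    exact (h.nodeRel_mem_sub_iff hlim (he _ u) u.2 (he n t) t.2 (e n t).2).1 hu
  · intro hs
    have hs2 : s ∈ E'.tree (n + 1) := E'.sub_subset n _ (e n t).2 hs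
    obtain ⟨u, hu⟩ := (e (n + 1)).surjective ⟨s, hs2⟩
    have hu2 : (e (n + 1) u).1 = s := congrArg Subtype.val hu
    exact ⟨u, (h.nodeRel_mem_sub_iff hlim (he _ u) u.2 (he n t) t.2 (e n t).2).2 (hu2 ▸ hs), hu2⟩

end IsTopIso

/-! ### Conditions as chains of top branches -/

namespace Condition

theorem len_add {μ : Ordinal.{0}} {E : Embrion Q μ} {n : ℕ} (t : E.Condition n) (k : ℕ)
    (hk : k < n + 1) : (t.val ⟨k, hk⟩).1.len + (k : Ordinal.{0}) = (t.val 0).1.len := by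
  induction k with
  | zero => simp
  | succ k ih =>
    have hp : (t.val ⟨k, by omega⟩).1.len = (t.val ⟨k + 1, hk⟩).1.len + 1 :=
      (t.proj ⟨k, by omega⟩).1
    rw [← ih (by omega), hp, add_assoc]
    congr 1
    -- The commutation takes place in `ℕ`, before the cast, since ordinal addition is not
    -- commutative.
    rw [add_comm k 1, Nat.cast_add, Nat.cast_one]

theorem len_eq {μ : Ordinal.{0}} {E E' : Embrion Q μ} {n : ℕ} (t : E.Condition n)
    (t' : E'.Condition n) (h : (t.val 0).1.len = (t'.val 0).1.len) (k : ℕ) (hk : k < n + 1) :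
    (t.val ⟨k, hk⟩).1.len = (t'.val ⟨k, hk⟩).1.len := by
  rw [← t.len_add k hk, ← t'.len_add k hk] at h
  exact Ordinal.add_right_cancel k |>.1 h

/-- A condition extends to a chain of elements of the top levels. -/
theorem exists_top (hlim : Order.IsSuccLimit lam) {n : ℕ} (t : E.Condition n) :
    ∃ s : ℕ → PSeq, ∀ k (hk : k < n + 1), s k ∈ level (E.tree k) lam ∧
      (t.val ⟨k, hk⟩).1 ≤ s k ∧
      ∀ m, k = m + 1 → s k ∈ branches (E.tree k) (E.sub (s m)) lam := by
  have key : ∀ m ≤ n, ∃ s : ℕ → PSeq, ∀ k (hk : k < n + 1), k ≤ m →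
      s k ∈ level (E.tree k) lam ∧ (t.val ⟨k, hk⟩).1 ≤ s k ∧
      ∀ m, k = m + 1 → s k ∈ branches (E.tree k) (E.sub (s m)) lam := by
    intro m hm
    induction m with
    | zero =>
      obtain ⟨s, hs, hts⟩ := (E.normal 0).exists_top (t.val 0).2
      refine ⟨fun _ => s, fun k hk hk0 => ?_⟩
      obtain rfl : k = 0 := by omega
      exact ⟨hs, hts, fun m hm => absurd hm (by omega)⟩
    | succ m ih =>
      obtain ⟨s, hs⟩ := ih (by omega)
      obtain ⟨hsm, htm, -⟩ := hs m (by omega) le_rfl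
      -- Coherence carries the next component into `sub (s m)`, and a branch through that subtree
      -- then extends it.
      have hmem : (t.val ⟨m + 1, by omega⟩).1 ∈ E.sub (s m) :=
        E.sub_mono (t.val ⟨m, by omega⟩).2 hsm.1 htm (t.proj ⟨m, by omega⟩).2
      obtain ⟨x, hx, htx⟩ := (E.limit_normal m lam hlim (Order.lt_add_one_iff.2 le_rfl) (s m)
        hsm).exists_top (Or.inl hmem)
      have hxb := E.level_sub_union_branches hsm hx
      refine ⟨Function.update s (m + 1) x, fun k hk hkm => ?_⟩
      rcases hkm.lt_or_eq with h | rfl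
      · obtain ⟨h1, h2, h3⟩ := hs k hk (by omega)
        rw [Function.update_of_ne h.ne]
        refine ⟨h1, h2, fun j hj => ?_⟩
        rw [Function.update_of_ne (by omega)]
        exact h3 j hj
      · rw [Function.update_self]
        refine ⟨hxb.1, htx, fun j hj => ?_⟩
        obtain rfl : m = j := by omega
        rwa [Function.update_of_ne (by omega)]
  obtain ⟨s, hs⟩ := key n le_rfl
  exact ⟨s, fun k hk => hs k hk (by omega)⟩

end Condition

/-- Chains of elements of the top levels form a partial isomorphism. -/
theorem isPartialIso_of_chains {n : ℕ} {s s' : ℕ → PSeq}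
    (hs : ∀ k < n + 1, s k ∈ level (E.tree k) lam ∧
      ∀ m, k = m + 1 → s k ∈ branches (E.tree k) (E.sub (s m)) lam)
    (hs' : ∀ k < n + 1, s' k ∈ level (E'.tree k) lam ∧
      ∀ m, k = m + 1 → s' k ∈ branches (E'.tree k) (E'.sub (s' m)) lam) :
    IsPartialIso E E' ((fun k => (k, s k, s' k)) '' Set.Iio (n + 1)) where
  finite := (Set.finite_Iio _).image _
  left_mem := by
    rintro _ _ _ ⟨k, hk, ⟨⟩⟩
    exact (hs _ hk).1
  right_mem := by
    rintro _ _ _ ⟨k, hk, ⟨⟩⟩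
    exact (hs' _ hk).1
  agree := by
    rintro _ _ _ _ _ ⟨k, hk, ⟨⟩⟩ ⟨j, hj, ⟨⟩⟩ γ
    -- Each level carries only one pair, so there is nothing to compare.
    simp
  proj := by
    rintro m _ _ ⟨k, hk, hkm⟩
    cases hkm
    exact ⟨s m, s' m, ⟨m, Set.mem_Iio.2 (by have := Set.mem_Iio.1 hk; omega), rfl⟩,
      (hs _ hk).2 m rfl, (hs' _ hk).2 m rfl⟩

end Embrion

theorem mainTheorem3 (Q : ℕ → Set PosRat) (hQ : IsRatPartition Q)
    (lam : Ordinal.{0}) (hlim : Order.IsSuccLimit lam) (hlam : lam < ω₁)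
    (E E' : Embrion Q (lam + 1)) (n : ℕ) (t : E.Condition n) (t' : E'.Condition n)
    (hlen : (t.val 0).1.len = (t'.val 0).1.len) :
    (∀ k : Fin (n + 1), (t.val k).1.len = (t'.val k).1.len ∧
      (t.val k).1.len + ((k : ℕ) : Ordinal.{0}) = (t.val 0).1.len) ∧
    ∃ h : Embrion.Iso E E', h.act t = t'.val := by
  refine ⟨fun k => ⟨t.len_eq t' hlen k k.2, t.len_add k k.2⟩, ?_⟩
  obtain ⟨s, hs⟩ := t.exists_top hlim
  obtain ⟨s', hs'⟩ := t'.exists_top hlim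
  obtain ⟨H, hH, htop⟩ := (Embrion.isPartialIso_of_chains
    (fun k hk => ⟨(hs k hk).1, (hs k hk).2.2⟩)
    (fun k hk => ⟨(hs' k hk).1, (hs' k hk).2.2⟩)).exists_isTopIso hlim
  obtain ⟨e, he⟩ := htop.exists_iso hlim
  refine ⟨e, funext fun k => Subtype.ext ?_⟩
  have hts := (hs k k.2).2.1
  have hts' := (hs' k k.2).2.1
  -- The two components are restrictions of matched branches to the same length, hence related;
  -- single-valuedness then identifies the image.
  have hrel : Embrion.NodeRel H lam k (t.val k).1 (t'.val k).1 :=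
    ⟨s k, s' k, (t.val k).1.len, hH ⟨k, k.2, rfl⟩, (hs k k.2).1.2 ▸ hts.1,
      (restrict_of_le hts).symm, by
        rw [t.len_eq t' hlen k k.2]; exact (restrict_of_le hts').symm⟩
  exact le_antisymm ((htop.nodeRel_le_iff (he k (t.val k)) hrel).1 le_rfl)
    ((htop.nodeRel_le_iff hrel (he k (t.val k))).1 le_rfl)
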